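/- Let $p$ be an odd prime, $\lambda_1\in\{0,\ldots,p-1\}$ and $\lambda=(\lambda_1,1)$. Let $J=J_{p,\lambda}$ be the group generated by $a_1,a_2,b_1,b_2$ subject to the relations that all triple commutators $[[x,y],z]$ are trivial (i.e. $J$ has nilpotency class at most $2$) and $$a_1^p=[a_1,b_1],\quad a_2^p=[a_1,b_1^{\lambda_1}b_2],\quad b_1^p=[a_2,b_1b_2],\quad b_2^p=[a_2,b_2],\quad [a_1,a_2]=[b_1,b_2]=1.$$ For a finite group $G$, let $\operatorname{Aff}(G)$ be the set of all maps $x\mapsto g\varphi(x)$ on $G$ with $g\in G$, $\varphi\in\operatorname{End}(G)$. For $f:G\to G$ let $\operatorname{affapp}(f)=\max_{A\in\operatorname{Aff}(G)}|\{x\in G: A(x)=f(x)\}|$ and $\operatorname{enapp}(f)=\max_{\varphi\in\operatorname{End}(G)}|\{x\in G:\varphi(x)=f(x)\}|$, and let $\operatorname{affapp}(G)=\min_{f:G\to G}\operatorname{affapp}(f)$ and $\operatorname{enapp}(G)=\min_{f:G\to G}\operatorname{enapp}(f)$. For $k,r\in\mathbb F_p^4$ put $$N(k,r)=a_1^{k_1}a_2^{k_2}b_1^{k_3}b_2^{k_4}[a_1,b_1]^{r_1}[a_1,b_2]^{r_2}[a_2,b_1]^{r_3}[a_2,b_2]^{r_4},$$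 where the exponents are the representatives in $\{0,\ldots,p-1\}$. Then: 1. Every element of $J$ can be written as $N(k,r)$ for exactly one pair $(k,r)\in\mathbb F_p^4\times\mathbb F_p^4$ (so $J$ is finite of order $p^8$). 2. If $\sigma$ is a linear automorphism of $\mathbb F_p^4$ whose only fixed vector is $0$, then the function $f:J\to J$ given by $f(N(k,r))=N(\sigma(k),\sigma(r))$ satisfies $\operatorname{affapp}(f)=1$. 3. $\operatorname{affapp}(J)=1$ and $\operatorname{enapp}(J)=0$. -/

import Mathlib

open scoped commutatorElement

/-- The approximability of `g : M₁ → M₂` by a family `F` of functions: the maximum over `f ∈ F` of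
the number of points at which `f` and `g` agree. -/
noncomputable def approximability {M₁ M₂ : Type*} (F : Set (M₁ → M₂)) (g : M₁ → M₂) : ℕ∞ :=
  ⨆ f ∈ F, {x : M₁ | f x = g x}.encard

/-- The minimum (worst-case) approximability by `F`, over all functions `g : M₁ → M₂`. -/
noncomputable def minApproximability {M₁ M₂ : Type*} (F : Set (M₁ → M₂)) : ℕ∞ :=
  ⨅ g : M₁ → M₂, approximability F g

/-- The endomorphisms of a group, as functions. -/
def endMaps (G : Type*) [Group G] : Set (G → G) :=
  {A | ∃ φ : G →* G, ∀ x, A x = φ x}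

/-- The affine maps `x ↦ g * φ x` of a group, with `φ` an endomorphism. -/
def affMaps (G : Type*) [Group G] : Set (G → G) :=
  {A | ∃ (g : G) (φ : G →* G), ∀ x, A x = g * φ x}

/-- The affine approximability of a function on a group. -/
noncomputable def affappFun {G : Type*} [Group G] (f : G → G) : ℕ∞ :=
  approximability (affMaps G) f

/-- The minimum endomorphic approximability of a group. -/
noncomputable def enapp (G : Type*) [Group G] : ℕ∞ :=
  minApproximability (endMaps G)

/-- The minimum affine approximability of a group. -/
noncomputable def affapp (G : Type*) [Group G] : ℕ∞ :=
  minApproximability (affMaps G)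

/-- The four generators of the Jonah–Konvisser groups. -/
inductive JKGen : Type
  | a₁ | a₂ | b₁ | b₂

open JKGen in
/-- The relators of the Jonah–Konvisser group with parameters `p` and `(l₁, l₂)`: triple
commutators (nilpotency class at most 2), and the relations
`a₁ ^ p = [a₁, b₁]`, `a₂ ^ p = [a₁, b₁ ^ l₁ * b₂ ^ l₂]`, `b₁ ^ p = [a₂, b₁ * b₂]`,
`b₂ ^ p = [a₂, b₂]`, `[a₁, a₂] = [b₁, b₂] = 1`. -/
def jkRels (p : ℕ) (l : ZMod p × ZMod p) : Set (FreeGroup JKGen) :=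
  let x : JKGen → FreeGroup JKGen := FreeGroup.of
  {w | ∃ u v t : FreeGroup JKGen, w = ⁅⁅u, v⁆, t⁆} ∪
  {(x a₁) ^ p * ⁅x a₁, x b₁⁆⁻¹,
   (x a₂) ^ p * ⁅x a₁, (x b₁) ^ l.1.val * (x b₂) ^ l.2.val⁆⁻¹,
   (x b₁) ^ p * ⁅x a₂, x b₁ * x b₂⁆⁻¹,
   (x b₂) ^ p * ⁅x a₂, x b₂⁆⁻¹,
   ⁅x a₁, x a₂⁆,
   ⁅x b₁, x b₂⁆}

/-- The Jonah–Konvisser group `J_{p,l}`. -/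
abbrev JK (p : ℕ) (l : ZMod p × ZMod p) : Type :=
  PresentedGroup (jkRels p l)

/-- A generator, as an element of the Jonah–Konvisser group. -/
def jkOf (p : ℕ) (l : ZMod p × ZMod p) (s : JKGen) : JK p l :=
  PresentedGroup.of s

open JKGen in
/-- The element in normal form with generator exponents `k` and commutator exponents `r`, the
exponents being the representatives in `{0, …, p - 1}`. -/
def jkNormalForm (p : ℕ) (l : ZMod p × ZMod p) (k r : Fin 4 → ZMod p) : JK p l :=
  let x : JKGen → JK p l := jkOf p l
  (x a₁) ^ (k 0).val * (x a₂) ^ (k 1).val * (x b₁) ^ (k 2).val * (x b₂) ^ (k 3).val *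
    ⁅x a₁, x b₁⁆ ^ (r 0).val * ⁅x a₁, x b₂⁆ ^ (r 1).val *
    ⁅x a₂, x b₁⁆ ^ (r 2).val * ⁅x a₂, x b₂⁆ ^ (r 3).val

/-!
In `J = JK p (l, 1)` both the commutator and the `p`-th power take values in the central subgroup
`[J, J]`, which has exponent `p`. As `p` is odd, the `p`-th power map is linear, and for these
relations it is an isomorphism from `V = J / [J, J]` onto `[J, J]`. Composing the commutator with
its inverse makes `V` an anticommutative algebra (`jkBracket`) on which every endomorphism of `J`
acts by an algebra endomorphism.

The only endomorphisms of this algebra are `0` and the identity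
(`eq_zero_or_eq_id_of_map_jkBracket`). A nonzero element of the kernel generates the whole algebra
as an ideal. An injective endomorphism maps each of the planes `A = ⟨a₁, a₂⟩` and `B = ⟨b₁, b₂⟩` to
`A` or `B`, because two independent vectors with trivial bracket lie both in `A` or both in `B`;
comparing coordinates then leaves only the identity. Hence an endomorphism of `J` either is trivial
on `[J, J]` with central values, or is the identity both on `[J, J]` and on `J / [J, J]`.

To see that `J` is as large as claimed, `J` is identified with a concrete group `JKModel p l` on
`(ℤ/p²)⁴`, with product `x + y - p · t(x, y)` for a bilinear map `t` (`jkTwist`). In it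
`x ^ p = p · x` and `⁅x, y⁆ = p · jkBracket x y`. The homomorphism `JKModel.ofJK` is injective
because the products `a₁ ^ i * a₂ ^ j * b₁ ^ k * b₂ ^ m` exhaust `J` (`exists_eq_zpow_mul`).

If `f` acts on normal forms by a fixed-point-free `σ` and agrees with `x ↦ g * φ x` at two points,
reduction modulo `[J, J]` shows that the vectors `k` of the two points have equal `σ k` or equal
`σ k - k`, so these vectors coincide, and then the same comparison inside `[J, J]` identifies the
vectors `r`. Finally, if `f` meets each affine map at most once, then `(f 1)⁻¹ * f` meets each
endomorphism in `1` only, and changing its value at `1` leaves no agreement at all.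
-/

/-! ### The anticommutative algebra of commutators and `p`-th powers -/

/-- The bilinear map pairing the `a`-part of `y` with the `b`-part of `x`. The product of the model
differs from addition by `-p` times this map; only moving an `a`-part to the left past a `b`-part
contributes, so that ordered products of generator powers acquire no correction. -/
def jkTwist {R : Type*} [CommRing R] (c : R) (x y : Fin 4 → R) : Fin 4 → R :=
  ![y 0 * (x 2 - c * x 3), y 0 * x 3, y 1 * x 2, y 1 * (x 3 - x 2)]

@[simp] theorem jkTwist_zero {R : Type*} [CommRing R] (c : R) (x y : Fin 4 → R) :
    jkTwist c x y 0 = y 0 * (x 2 - c * x 3) := rfl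

@[simp] theorem jkTwist_one {R : Type*} [CommRing R] (c : R) (x y : Fin 4 → R) :
    jkTwist c x y 1 = y 0 * x 3 := rfl

@[simp] theorem jkTwist_two {R : Type*} [CommRing R] (c : R) (x y : Fin 4 → R) :
    jkTwist c x y 2 = y 1 * x 2 := rfl

@[simp] theorem jkTwist_three {R : Type*} [CommRing R] (c : R) (x y : Fin 4 → R) :
    jkTwist c x y 3 = y 1 * (x 3 - x 2) := rfl

/-- The bracket on `V = J / [J, J]` in the basis `a₁, a₂, b₁, b₂`: the unique class whose `p`-th
power is the commutator, with `c = l`. It is given by `[a₁, b₁] = a₁`, `[a₁, b₂] = a₂ - c a₁`,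
`[a₂, b₁] = b₁ - b₂`, `[a₂, b₂] = b₂` and `[a₁, a₂] = [b₁, b₂] = 0`. -/
def jkBracket {R : Type*} [CommRing R] (c : R) (x y : Fin 4 → R) : Fin 4 → R :=
  jkTwist c y x - jkTwist c x y

section Algebra

variable {K : Type*} [Field K] {c : K}

theorem jkBracket_apply (c : K) (x y : Fin 4 → K) :
    jkBracket c x y = ![x 0 * (y 2 - c * y 3) - y 0 * (x 2 - c * x 3), x 0 * y 3 - y 0 * x 3,
      x 1 * y 2 - y 1 * x 2, x 1 * (y 3 - y 2) - y 1 * (x 3 - x 2)] := by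
  ext i; fin_cases i <;> simp [jkBracket]

theorem jkBracket_eq_zero_iff {x y : Fin 4 → K} :
    jkBracket c x y = 0 ↔ x 0 * y 2 = y 0 * x 2 ∧ x 0 * y 3 = y 0 * x 3 ∧
      x 1 * y 2 = y 1 * x 2 ∧ x 1 * y 3 = y 1 * x 3 := by
  rw [jkBracket_apply, funext_iff]
  simp only [Fin.forall_fin_succ, Pi.zero_apply]
  simp
  constructor
  · rintro ⟨h0, h1, h2, h3⟩
    refine ⟨?_, ?_, ?_, ?_⟩
    · linear_combination h0 + c * h1
    · linear_combination h1
    · linear_combination h2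
    · linear_combination h3 + h2
  · rintro ⟨h0, h1, h2, h3⟩
    refine ⟨?_, ?_, ?_, ?_⟩
    · linear_combination h0 - c * h1
    · linear_combination h1
    · linear_combination h2
    · linear_combination h3 - h2

/-- Up to a change of basis the bracket sends `x, y` to `α ⊗ β' - α' ⊗ β`, where `α, α'` are the
`a`-parts and `β, β'` the `b`-parts of `x, y`. A vector with both parts nonzero therefore commutes
with its multiples only. -/
theorem mem_or_mem_of_jkBracket_eq_zero {x y : Fin 4 → K} (hx : x ≠ 0)
    (hy : ∀ t : K, y ≠ t • x) (h : jkBracket c x y = 0) :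
    (x 2 = 0 ∧ x 3 = 0 ∧ y 2 = 0 ∧ y 3 = 0) ∨ (x 0 = 0 ∧ x 1 = 0 ∧ y 0 = 0 ∧ y 1 = 0) := by
  obtain ⟨h02, h03, h12, h13⟩ := jkBracket_eq_zero_iff.1 h
  have key : ∀ t : K, ¬(y 0 = t * x 0 ∧ y 1 = t * x 1 ∧ y 2 = t * x 2 ∧ y 3 = t * x 3) := by
    rintro t ⟨h0, h1, h2, h3⟩
    exact hy t (by ext i; fin_cases i <;> simpa)
  have hx' : x 0 ≠ 0 ∨ x 1 ≠ 0 ∨ x 2 ≠ 0 ∨ x 3 ≠ 0 := by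
    by_contra! hc
    exact hx (by ext i; fin_cases i <;> simp [hc])
  rcases hx' with h0 | h0 | h0 | h0
  · have := key (y 0 / x 0)
    grind
  · have := key (y 1 / x 1)
    grind
  · have := key (y 2 / x 2)
    grind
  · have := key (y 3 / x 3)
    grind

variable {M : (Fin 4 → K) →ₗ[K] (Fin 4 → K)}

theorem eq_sum_basis (x : Fin 4 → K) :
    x = x 0 • ![1, 0, 0, 0] + x 1 • ![0, 1, 0, 0] + x 2 • ![0, 0, 1, 0] + x 3 • ![0, 0, 0, 1] := by
  ext i; fin_cases i <;> simp

theorem eq_zero_of_apply_basis (h0 : M ![1, 0, 0, 0] = 0) (h1 : M ![0, 1, 0, 0] = 0)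
    (h2 : M ![0, 0, 1, 0] = 0) (h3 : M ![0, 0, 0, 1] = 0) : M = 0 := by
  refine LinearMap.ext fun x => ?_
  rw [eq_sum_basis x]
  simp only [map_add, map_smul, h0, h1, h2, h3, smul_zero, add_zero, LinearMap.zero_apply]

/-- The kernel is an ideal, and the algebra is simple: any nonzero ideal contains `a₁` and `a₂`, and
the ideal generated by these is everything. -/
theorem eq_zero_of_apply_eq_zero (hM : ∀ x y, M (jkBracket c x y) = jkBracket c (M x) (M y))
    {x : Fin 4 → K} (hx : x ≠ 0) (hMx : M x = 0) : M = 0 := by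
  have ideal : ∀ {y} (z), M y = 0 → M (jkBracket c y z) = 0 := fun {y} z hy => by
    rw [hM, hy, jkBracket_eq_zero_iff]; simp
  have scale : ∀ {t : K} {y}, t ≠ 0 → M (t • y) = 0 → M y = 0 := fun {t y} ht hy => by
    rw [map_smul] at hy
    exact (smul_eq_zero.1 hy).resolve_left ht
  have ofA : M ![1, 0, 0, 0] = 0 → M ![0, 1, 0, 0] = 0 → M = 0 := fun h0 h1 => by
    have h3 : M ![0, 0, 0, 1] = 0 := by
      have := ideal ![0, 0, 0, 1] h1
      rw [jkBracket_apply] at this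
      simpa using this
    have h2 : M ![0, 0, 1, -1] = 0 := by
      have := ideal ![0, 0, 1, 0] h1
      rw [jkBracket_apply] at this
      simpa using this
    have e : (![0, 0, 1, 0] : Fin 4 → K) = ![0, 0, 1, -1] + ![0, 0, 0, 1] := by
      ext i; fin_cases i <;> simp
    exact eq_zero_of_apply_basis h0 h1 (by rw [e, map_add, h2, h3, add_zero]) h3
  -- A kernel vector with `a₁`-coordinate `t ≠ 0` brackets to `t a₁` and `t a₂`.
  have of0 : ∀ {y : Fin 4 → K}, y 0 ≠ 0 → M y = 0 → M = 0 := fun {y} hy0 hy => by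
    have h1 := ideal ![0, 0, 1, 0] (ideal ![0, 0, 1, 0] hy)
    have h2 := ideal ![0, 0, c, 1] (ideal ![0, 0, 1, 0] hy)
    have e1 : jkBracket c (jkBracket c y ![0, 0, 1, 0]) ![0, 0, 1, 0] =
        y 0 • ![1, 0, 0, 0] := by
      simp only [jkBracket_apply]
      ext i; fin_cases i <;> simp
    have e2 : jkBracket c (jkBracket c y ![0, 0, 1, 0]) ![0, 0, c, 1] =
        y 0 • ![0, 1, 0, 0] := by
      simp only [jkBracket_apply]
      ext i; fin_cases i <;> simp
    exact ofA (scale hy0 (e1 ▸ h1)) (scale hy0 (e2 ▸ h2))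
  have of1 : ∀ {y : Fin 4 → K}, y 0 = 0 → y 1 ≠ 0 → M y = 0 → M = 0 := fun {y} hy0 hy1 hy => by
    refine of0 ?_ (ideal ![1, 0, 0, 0] (ideal ![0, 0, 1, 1] hy))
    simp [jkBracket_apply, hy0, hy1]
  by_cases hx0 : x 0 = 0
  · by_cases hx1 : x 1 = 0
    · have hy := ideal ![1, 0, 0, 0] hMx
      by_cases h : x 2 - c * x 3 = 0
      · have h3 : x 3 ≠ 0 := fun h3 => hx <| by
          rw [h3, mul_zero, sub_zero] at h
          ext i; fin_cases i <;> simpa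
        exact of1 (by simp [jkBracket_apply, hx0, h]) (by simp [jkBracket_apply, hx1, h3]) hy
      · exact of0 (by simp [jkBracket_apply, hx0, h, -neg_sub]) hy
    · exact of1 hx0 hx1 hMx
  · exact of0 hx0 hMx

/-- The algebra `(K ^ 4, jkBracket)` has no endomorphisms besides `0` and the identity. -/
theorem eq_zero_or_eq_id_of_map_jkBracket
    (hM : ∀ x y, M (jkBracket c x y) = jkBracket c (M x) (M y)) : M = 0 ∨ M = LinearMap.id := by
  refine or_iff_not_imp_left.2 fun hM0 => ?_
  have inj : ∀ x, M x = 0 → x = 0 := fun x hx => by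
    by_contra h
    exact hM0 (eq_zero_of_apply_eq_zero hM h hx)
  -- Independent vectors with trivial bracket have images with the same properties.
  have pair : ∀ x y : Fin 4 → K, x ≠ 0 → (∀ t : K, y ≠ t • x) → jkBracket c x y = 0 →
      (M x 2 = 0 ∧ M x 3 = 0 ∧ M y 2 = 0 ∧ M y 3 = 0) ∨
        (M x 0 = 0 ∧ M x 1 = 0 ∧ M y 0 = 0 ∧ M y 1 = 0) := fun x y hx hy h =>
    mem_or_mem_of_jkBracket_eq_zero (fun h0 => hx (inj x h0))
      (fun t ht => hy t (sub_eq_zero.1 (inj _ (by rw [map_sub, map_smul, ht, sub_self]))))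
      (by rw [← hM, h, map_zero])
  have hA := pair ![1, 0, 0, 0] ![0, 1, 0, 0] (by simp) (by simp)
    (by simp [jkBracket_eq_zero_iff])
  have hB := pair ![0, 0, 1, 0] ![0, 0, 0, 1] (by simp) (by simp)
    (by simp [jkBracket_eq_zero_iff])
  have e1 : M ![1, 0, 0, 0] = jkBracket c (M ![1, 0, 0, 0]) (M ![0, 0, 1, 0]) := by
    rw [← hM, jkBracket_apply]; simp
  have e2 : M ![0, 1, 0, 0] - c • M ![1, 0, 0, 0] =
      jkBracket c (M ![1, 0, 0, 0]) (M ![0, 0, 0, 1]) := by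
    rw [← hM, jkBracket_apply, ← map_smul, ← map_sub]
    congr 1
    ext i; fin_cases i <;> simp
  have e3 : M ![0, 0, 1, 0] - M ![0, 0, 0, 1] =
      jkBracket c (M ![0, 1, 0, 0]) (M ![0, 0, 1, 0]) := by
    rw [← hM, jkBracket_apply, ← map_sub]; simp
  have e4 : M ![0, 0, 0, 1] = jkBracket c (M ![0, 1, 0, 0]) (M ![0, 0, 0, 1]) := by
    rw [← hM, jkBracket_apply]; simp
  have n0 : M ![1, 0, 0, 0] ≠ 0 := fun h => by simpa using inj _ h
  have n1 : M ![0, 1, 0, 0] ≠ 0 := fun h => by simpa using inj _ h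
  have n2 : M ![0, 0, 1, 0] ≠ 0 := fun h => by simpa using inj _ h
  have n23 : ∀ s t : K, s • M ![0, 0, 1, 0] + t • M ![0, 0, 0, 1] = 0 → s = 0 ∧ t = 0 :=
    fun s t h => by
      rw [← map_smul, ← map_smul, ← map_add] at h
      simpa using inj _ h
  suffices h : M ![1, 0, 0, 0] = ![1, 0, 0, 0] ∧ M ![0, 1, 0, 0] = ![0, 1, 0, 0] ∧
      M ![0, 0, 1, 0] = ![0, 0, 1, 0] ∧ M ![0, 0, 0, 1] = ![0, 0, 0, 1] by
    obtain ⟨h0, h1, h2, h3⟩ := h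
    exact sub_eq_zero.1 (eq_zero_of_apply_basis (by simp [h0]) (by simp [h1]) (by simp [h2])
      (by simp [h3]))
  clear hM pair inj hM0
  generalize M ![1, 0, 0, 0] = m at *
  generalize M ![0, 1, 0, 0] = n at *
  generalize M ![0, 0, 1, 0] = q at *
  generalize M ![0, 0, 0, 1] = s at *
  -- Only the coordinates of the four images matter from here on.
  simp only [jkBracket_apply, funext_iff, Fin.forall_fin_succ, ne_eq] at *
  simp at *
  -- According to whether each of `A`, `B` is mapped to `A` or to `B`.
  rcases hA with hA | hA <;> rcases hB with hB | hB
  · grind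
  -- If both planes are preserved, the coordinates are determined one after the other.
  · have m1 : m 1 = 0 := by grind
    have m0 : m 0 ≠ 0 := by grind
    have q3 : q 3 = 0 := by grind
    have q2 : q 2 ≠ 0 := by grind
    have q2' : q 2 = 1 := by grind
    have n0' : n 0 = 0 := by grind
    have n1' : n 1 = 1 := by grind
    grind
  -- If the planes are swapped, the images of `b₁` and `b₂` are proportional.
  · have q0 : q 0 = 0 := by grind
    have s0 : s 0 = 0 := by grind
    have := n23 (s 1) (-q 1)
    grind
  · grind

end Algebra

/-! ### A model on `(ℤ/p²)⁴` and its endomorphisms -/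

section Residues

variable (p : ℕ)

/-- Reduction `ℤ/p² → ℤ/p`. -/
def redModP : ZMod (p ^ 2) →+* ZMod p :=
  ZMod.castHom (dvd_pow_self p two_ne_zero) (ZMod p)

variable {p}

theorem natCast_mul_self_eq_zero : (p : ZMod (p ^ 2)) * p = 0 := by
  rw [← Nat.cast_mul, ← sq, ZMod.natCast_self]

variable [Fact p.Prime]

theorem redModP_val (s : ZMod p) : redModP p (s.val : ZMod (p ^ 2)) = s := by simp

theorem natCast_mul_eq_zero_iff {t : ZMod (p ^ 2)} :
    (p : ZMod (p ^ 2)) * t = 0 ↔ redModP p t = 0 := by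
  obtain ⟨n, rfl⟩ := ZMod.natCast_zmod_surjective t
  rw [← Nat.cast_mul, ZMod.natCast_eq_zero_iff, map_natCast, ZMod.natCast_eq_zero_iff, sq,
    Nat.mul_dvd_mul_iff_left (Fact.out : p.Prime).pos]

theorem natCast_mul_inj {t u : ZMod (p ^ 2)} :
    (p : ZMod (p ^ 2)) * t = (p : ZMod (p ^ 2)) * u ↔ redModP p t = redModP p u := by
  rw [← sub_eq_zero, ← mul_sub, natCast_mul_eq_zero_iff, map_sub, sub_eq_zero]

theorem redModP_eq_zero_iff {t : ZMod (p ^ 2)} :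
    redModP p t = 0 ↔ ∃ u, t = (p : ZMod (p ^ 2)) * u := by
  constructor
  · obtain ⟨n, rfl⟩ := ZMod.natCast_zmod_surjective t
    rw [map_natCast, ZMod.natCast_eq_zero_iff]
    rintro ⟨m, rfl⟩
    exact ⟨m, by push_cast; rfl⟩
  · rintro ⟨u, rfl⟩
    simp

end Residues

/-- The underlying set `(ℤ/p²)⁴` of the model of `JK p (l, 1)`; the coordinates are the exponents of
`a₁, a₂, b₁, b₂`, the commutators being expressed as `p`-th powers. -/
@[ext]
structure JKModel (p : ℕ) (l : ZMod p) where
  coord : Fin 4 → ZMod (p ^ 2)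

namespace JKModel

variable {p : ℕ} {l : ZMod p}

theorem ext' {x y : JKModel p l} (h0 : x.coord 0 = y.coord 0) (h1 : x.coord 1 = y.coord 1)
    (h2 : x.coord 2 = y.coord 2) (h3 : x.coord 3 = y.coord 3) : x = y := by
  ext i; fin_cases i <;> assumption

instance : Mul (JKModel p l) :=
  ⟨fun x y => ⟨x.coord + y.coord -
    (p : ZMod (p ^ 2)) • jkTwist (l.val : ZMod (p ^ 2)) x.coord y.coord⟩⟩

instance : One (JKModel p l) := ⟨⟨0⟩⟩

instance : Inv (JKModel p l) :=
  ⟨fun x => ⟨-x.coord - (p : ZMod (p ^ 2)) • jkTwist (l.val : ZMod (p ^ 2)) x.coord x.coord⟩⟩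

theorem coord_mul (x y : JKModel p l) : (x * y).coord = x.coord + y.coord -
    (p : ZMod (p ^ 2)) • jkTwist (l.val : ZMod (p ^ 2)) x.coord y.coord := rfl

theorem coord_one : (1 : JKModel p l).coord = 0 := rfl

theorem coord_inv (x : JKModel p l) : x⁻¹.coord =
    -x.coord - (p : ZMod (p ^ 2)) • jkTwist (l.val : ZMod (p ^ 2)) x.coord x.coord := rfl

instance : Group (JKModel p l) :=
  Group.ofLeftAxioms
    (fun x y z => by
      have hp := natCast_mul_self_eq_zero (p := p)
      apply ext' <;> simp [coord_mul] <;> grind)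
    (fun x => by apply ext' <;> simp [coord_mul, coord_one])
    (fun x => by
      have hp := natCast_mul_self_eq_zero (p := p)
      apply ext' <;> simp [coord_mul, coord_one, coord_inv] <;> grind)

theorem coord_pow (x : JKModel p l) (n : ℕ) : (x ^ n).coord = (n : ZMod (p ^ 2)) • x.coord -
    ((n.choose 2 : ℕ) * (p : ZMod (p ^ 2))) • jkTwist (l.val : ZMod (p ^ 2)) x.coord x.coord := by
  have hp := natCast_mul_self_eq_zero (p := p)
  induction n with
  | zero => simp [coord_one]
  | succ n ih =>
    have hc : (n + 1).choose 2 = n + n.choose 2 := by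
      rw [Nat.choose_succ_succ' n 1, Nat.choose_one_right]
    rw [_root_.pow_succ x n, coord_mul, ih, hc]
    refine congrArg coord (ext' (x := ⟨_⟩) (y := ⟨_⟩) (l := l) ?_ ?_ ?_ ?_) <;>
      simp <;> grind

variable [Fact p.Prime]

/-- The embedding `v ↦ p · v` of `V = (ℤ/p)⁴` onto the commutator subgroup of the model. -/
def embed (l : ZMod p) (v : Fin 4 → ZMod p) : JKModel p l :=
  ⟨fun i => p * ((v i).val : ZMod (p ^ 2))⟩

theorem embed_red (u : Fin 4 → ZMod (p ^ 2)) :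
    embed l (redModP p ∘ u) = ⟨(p : ZMod (p ^ 2)) • u⟩ := by
  ext i
  exact (natCast_mul_inj (p := p)).2 (redModP_val _)

theorem mk_smul_eq {u : Fin 4 → ZMod (p ^ 2)} {v} (h : redModP p ∘ u = v) :
    (⟨(p : ZMod (p ^ 2)) • u⟩ : JKModel p l) = embed l v := by rw [← h, embed_red]

theorem redModP_comp_val (v : Fin 4 → ZMod p) :
    (redModP p ∘ fun i => ((v i).val : ZMod (p ^ 2))) = v := by
  ext i; exact redModP_val _

theorem exists_embed_eq (v : Fin 4 → ZMod p) : ∃ u : Fin 4 → ZMod (p ^ 2),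
    redModP p ∘ u = v ∧ embed l v = ⟨(p : ZMod (p ^ 2)) • u⟩ :=
  ⟨_, redModP_comp_val v, rfl⟩

/-- The projection of the model onto `V = (ℤ/p)⁴`, its quotient by the commutator subgroup. -/
def red (x : JKModel p l) : Fin 4 → ZMod p := redModP p ∘ x.coord

theorem red_mul (x y : JKModel p l) : red (x * y) = red x + red y := by
  ext i; simp [red, coord_mul]

theorem red_one : red (1 : JKModel p l) = 0 := by
  ext i; simp [red, coord_one]

theorem red_surjective : Function.Surjective (red : JKModel p l → _) :=
  fun v => ⟨⟨fun i => ((v i).val : ZMod (p ^ 2))⟩, redModP_comp_val v⟩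

theorem red_embed (v : Fin 4 → ZMod p) : red (embed l v) = 0 := by
  ext i; simp [red, embed]

theorem red_eq_zero_iff {x : JKModel p l} : red x = 0 ↔ ∃ v, x = embed l v := by
  constructor
  · intro h
    choose u hu using fun i => redModP_eq_zero_iff.1 (congrFun h i)
    exact ⟨redModP p ∘ u, by rw [embed_red]; ext i; exact hu i⟩
  · rintro ⟨v, rfl⟩
    exact red_embed v

theorem embed_injective : Function.Injective (embed l) := fun v w h => by
  ext i
  have := (natCast_mul_inj (p := p)).1 (congrFun (congrArg coord h) i)
  rwa [redModP_val, redModP_val] at this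

theorem mul_embed (x : JKModel p l) (u : Fin 4 → ZMod (p ^ 2)) {v} (hu : redModP p ∘ u = v) :
    x * embed l v = ⟨x.coord + (p : ZMod (p ^ 2)) • u⟩ := by
  have hp := natCast_mul_self_eq_zero (p := p)
  rw [← mk_smul_eq hu]
  apply ext' <;> simp [coord_mul] <;> grind

theorem embed_mul (x : JKModel p l) (u : Fin 4 → ZMod (p ^ 2)) {v} (hu : redModP p ∘ u = v) :
    embed l v * x = ⟨x.coord + (p : ZMod (p ^ 2)) • u⟩ := by
  have hp := natCast_mul_self_eq_zero (p := p)
  rw [← mk_smul_eq hu]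
  apply ext' <;> simp [coord_mul] <;> grind

theorem commute_embed (x : JKModel p l) (v : Fin 4 → ZMod p) : x * embed l v = embed l v * x := by
  rw [mul_embed x _ (redModP_comp_val v), embed_mul x _ (redModP_comp_val v)]

theorem embed_add (v w : Fin 4 → ZMod p) : embed l (v + w) = embed l v * embed l w := by
  obtain ⟨u, hu, hv⟩ := exists_embed_eq (l := l) v
  obtain ⟨u', hu', -⟩ := exists_embed_eq (l := l) w
  have : redModP p ∘ (u + u') = v + w := by rw [← hu, ← hu']; ext i; simp
  rw [← mk_smul_eq this, mul_embed _ _ hu', hv, smul_add]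

theorem embed_zero : embed l (0 : Fin 4 → ZMod p) = 1 := by
  ext i; simp [embed, coord_one]

theorem embed_nsmul (n : ℕ) (v : Fin 4 → ZMod p) : embed l (n • v) = embed l v ^ n := by
  induction n with
  | zero => simp [embed_zero]
  | succ n ih => rw [succ_nsmul, embed_add, ih, pow_succ]

/-- The correction term `p · (p choose 2) · t(x, x)` of the `p`-th power vanishes as `p` is odd. -/
theorem pow_prime (hp : Odd p) (x : JKModel p l) : x ^ p = embed l (red x) := by
  rw [red, embed_red]
  have h : ((p.choose 2 : ℕ) : ZMod (p ^ 2)) * p = 0 := by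
    have h2 : p ∣ p.choose 2 := (Fact.out : p.Prime).dvd_choose_self two_ne_zero
      ((Fact.out : p.Prime).two_le.lt_of_ne (by rintro rfl; exact absurd hp (by decide)))
    rw [← Nat.cast_mul, ZMod.natCast_eq_zero_iff, sq]
    exact Nat.mul_dvd_mul_right h2 _
  ext1
  rw [coord_pow, h, zero_smul, sub_zero]

theorem commutator_eq (x y : JKModel p l) :
    ⁅x, y⁆ = embed l (jkBracket l (red x) (red y)) := by
  rw [commutatorElement_def, mul_inv_eq_iff_eq_mul, mul_inv_eq_iff_eq_mul]
  have h : redModP p ∘ jkBracket (l.val : ZMod (p ^ 2)) x.coord y.coord =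
      jkBracket l (red x) (red y) := by
    ext i; fin_cases i <;> simp [jkBracket, red]
  rw [mul_assoc, embed_mul _ _ h]
  ext1
  simp only [coord_mul, jkBracket]
  module

theorem commutator_commutator (x y z : JKModel p l) : ⁅⁅x, y⁆, z⁆ = 1 := by
  rw [commutatorElement_eq_one_iff_mul_comm, commutator_eq x y, commute_embed]

theorem red_pow (x : JKModel p l) (n : ℕ) : red (x ^ n) = n • red x := by
  induction n with
  | zero => simp [red_one]
  | succ n ih => rw [pow_succ, red_mul, ih, succ_nsmul]

/-- The map induced by `φ` on `V` is compatible with `p`-th powers and with commutators, so it is an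
endomorphism of the algebra `jkBracket`. -/
theorem endo_dichotomy (hp : Odd p) (φ : JKModel p l →* JKModel p l) :
    ((∀ x, red (φ x) = 0) ∧ ∀ v, φ (embed l v) = 1) ∨
      ((∀ x, red (φ x) = red x) ∧ ∀ v, φ (embed l v) = embed l v) := by
  have h0 : ∀ x, φ (embed l (red x)) = embed l (red (φ x)) := fun x => by
    rw [← pow_prime hp, map_pow, pow_prime hp]
  have wd : ∀ x y, red x = red y → red (φ x) = red (φ y) := fun x y h =>
    embed_injective (by rw [← h0, ← h0, h])
  choose s hs using red_surjective (p := p) (l := l)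
  let M' : (Fin 4 → ZMod p) →+ (Fin 4 → ZMod p) := AddMonoidHom.mk' (fun v => red (φ (s v)))
    fun v w => by rw [← red_mul, ← map_mul]; exact wd _ _ (by rw [red_mul, hs, hs, hs])
  let M := M'.toZModLinearMap p
  have hM : ∀ x, red (φ x) = M (red x) := fun x => wd _ _ (hs _).symm
  have hE : ∀ v, φ (embed l v) = embed l (M v) := fun v => by
    obtain ⟨x, rfl⟩ := red_surjective (l := l) v
    rw [h0, hM]
  have hB : ∀ v w, M (jkBracket l v w) = jkBracket l (M v) (M w) := fun v w => by
    obtain ⟨x, rfl⟩ := red_surjective (l := l) v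
    obtain ⟨y, rfl⟩ := red_surjective (l := l) w
    apply embed_injective (l := l)
    rw [← hE, ← commutator_eq, map_commutatorElement, commutator_eq, hM, hM]
  rcases eq_zero_or_eq_id_of_map_jkBracket hB with h | h
  · exact .inl ⟨fun x => by rw [hM, h]; rfl, fun v => by rw [hE, h]; exact embed_zero⟩
  · exact .inr ⟨fun x => by rw [hM, h]; rfl, fun v => by rw [hE, h]; rfl⟩

end JKModel

/-! ### The isomorphism with the Jonah–Konvisser group and the normal form -/

section ClassTwo

variable {G : Type*} [Group G]

theorem zpow_mul_zpow_of_mul_eq {a b z : G} (hza : Commute z a) (hzb : Commute z b)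
    (h : b * a = z * (a * b)) (m n : ℤ) : b ^ m * a ^ n = z ^ (m * n) * (a ^ n * b ^ m) := by
  have h1 : a * b * a⁻¹ = z⁻¹ * b := by
    rw [mul_inv_eq_iff_eq_mul, mul_assoc, h, inv_mul_cancel_left]
  have h2 : a * b ^ m * a⁻¹ = z⁻¹ ^ m * b ^ m := by
    rw [← conj_zpow, h1, hzb.inv_left.mul_zpow]
  have h3 : b ^ m * a * (b ^ m)⁻¹ = z ^ m * a := by
    rw [mul_inv_eq_iff_eq_mul, mul_assoc, mul_inv_eq_iff_eq_mul.1 h2, inv_zpow, mul_assoc,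
      mul_inv_cancel_left]
  have h4 : b ^ m * a ^ n * (b ^ m)⁻¹ = z ^ (m * n) * a ^ n := by
    rw [← conj_zpow, h3, (hza.zpow_left m).mul_zpow, zpow_mul]
  rw [← mul_assoc, ← h4, inv_mul_cancel_right]

theorem commutator_mul_right_of_central {a b c : G} (h : ∀ x, Commute ⁅a, c⁆ x) :
    ⁅a, b * c⁆ = ⁅a, b⁆ * ⁅a, c⁆ := by
  have : ⁅a, b * c⁆ = ⁅a, b⁆ * (b * ⁅a, c⁆ * b⁻¹) := by
    simp only [commutatorElement_def]; group
  rw [this, ← (h b).eq, mul_inv_cancel_right]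

theorem commutator_zpow_right_of_central {a b : G} (h : ∀ x, Commute ⁅a, b⁆ x) (n : ℤ) :
    ⁅a, b ^ n⁆ = ⁅a, b⁆ ^ n := by
  have := zpow_mul_zpow_of_mul_eq (h b) (h a) (by simp [commutatorElement_def, mul_assoc]) 1 n
  rw [commutatorElement_def, mul_inv_eq_iff_eq_mul, mul_inv_eq_iff_eq_mul]
  simpa [mul_assoc] using this

theorem commutator_zpow_left_of_central {a b : G} (h : ∀ x, Commute ⁅a, b⁆ x) (n : ℤ) :
    ⁅a ^ n, b⁆ = ⁅a, b⁆ ^ n := by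
  have := zpow_mul_zpow_of_mul_eq (h b) (h a) (by simp [commutatorElement_def, mul_assoc]) n 1
  rw [commutatorElement_def, mul_inv_eq_iff_eq_mul, mul_inv_eq_iff_eq_mul]
  simpa [mul_assoc] using this

theorem zpow_eq_pow_val {g : G} {n : ℕ} [NeZero n] (h : g ^ n = 1) (i : ℤ) :
    g ^ i = g ^ (i : ZMod n).val := by
  rw [← zpow_natCast, ZMod.val_intCast, zpow_eq_zpow_emod' i h]

end ClassTwo

namespace JKModel

variable {p : ℕ} {l : ZMod p} [Fact p.Prime]

/-- The images of the generators in the model. -/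
def gen (l : ZMod p) : JKGen → JKModel p l
  | .a₁ => ⟨![1, 0, 0, 0]⟩
  | .a₂ => ⟨![0, 1, 0, 0]⟩
  | .b₁ => ⟨![0, 0, 1, 0]⟩
  | .b₂ => ⟨![0, 0, 0, 1]⟩

theorem red_a₁ : red (gen l .a₁) = ![1, 0, 0, 0] := by
  ext i; fin_cases i <;> simp [red, gen]

theorem red_a₂ : red (gen l .a₂) = ![0, 1, 0, 0] := by
  ext i; fin_cases i <;> simp [red, gen]

theorem red_b₁ : red (gen l .b₁) = ![0, 0, 1, 0] := by
  ext i; fin_cases i <;> simp [red, gen]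

theorem red_b₂ : red (gen l .b₂) = ![0, 0, 0, 1] := by
  ext i; fin_cases i <;> simp [red, gen]

theorem lift_gen_eq_one (hp : Odd p) : ∀ r ∈ jkRels p (l, 1), FreeGroup.lift (gen l) r = 1 := by
  rintro r (⟨u, v, t, rfl⟩ | h)
  · simp only [map_commutatorElement, commutator_commutator]
  · simp only [Set.mem_insert_iff, Set.mem_singleton_iff] at h
    rcases h with rfl | rfl | rfl | rfl | rfl | rfl
    all_goals
      simp only [map_mul, map_inv, map_pow, map_commutatorElement, FreeGroup.lift_apply_of,
        mul_inv_eq_one]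
      simp only [pow_prime hp, commutator_eq, red_mul, red_pow, red_a₁, red_a₂, red_b₁,
        red_b₂, ZMod.val_one, ← embed_zero (l := l), embed_injective.eq_iff, jkBracket_apply]
      ext i; fin_cases i <;> simp

/-- The homomorphism from the presented group to the model; it is an isomorphism by
`JKModel.ofJK_bijective`. -/
def ofJK (hp : Odd p) (l : ZMod p) : JK p (l, 1) →* JKModel p l :=
  PresentedGroup.toGroup (lift_gen_eq_one hp)

theorem ofJK_gen (hp : Odd p) (s : JKGen) : ofJK hp l (jkOf p (l, 1) s) = gen l s :=
  PresentedGroup.toGroup.of _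

end JKModel

section Presentation
open JKGen

variable {p : ℕ} {l : ZMod p}

theorem jk_commutator_commutator (x y z : JK p (l, 1)) : ⁅⁅x, y⁆, z⁆ = 1 := by
  obtain ⟨u, rfl⟩ := PresentedGroup.mk_surjective _ x
  obtain ⟨v, rfl⟩ := PresentedGroup.mk_surjective _ y
  obtain ⟨t, rfl⟩ := PresentedGroup.mk_surjective _ z
  simp only [← map_commutatorElement]
  exact PresentedGroup.one_of_mem (Or.inl ⟨u, v, t, rfl⟩)

theorem jk_commute (x y z : JK p (l, 1)) : Commute ⁅x, y⁆ z :=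
  commutatorElement_eq_one_iff_commute.1 (jk_commutator_commutator x y z)

theorem jk_a₁_pow : jkOf p (l, 1) a₁ ^ p = ⁅jkOf p (l, 1) a₁, jkOf p (l, 1) b₁⁆ :=
  mul_inv_eq_one.1 (PresentedGroup.one_of_mem (rels := jkRels p (l, 1)) (Or.inr (Or.inl rfl)))

theorem jk_b₁_pow_eq : jkOf p (l, 1) b₁ ^ p =
    ⁅jkOf p (l, 1) a₂, jkOf p (l, 1) b₁ * jkOf p (l, 1) b₂⁆ :=
  mul_inv_eq_one.1 (PresentedGroup.one_of_mem (rels := jkRels p (l, 1))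
    (Or.inr (Or.inr (Or.inr (Or.inl rfl)))))

theorem jk_b₂_pow : jkOf p (l, 1) b₂ ^ p = ⁅jkOf p (l, 1) a₂, jkOf p (l, 1) b₂⁆ :=
  mul_inv_eq_one.1 (PresentedGroup.one_of_mem (rels := jkRels p (l, 1))
    (Or.inr (Or.inr (Or.inr (Or.inr (Or.inl rfl))))))

theorem jk_a₁_commute_a₂ : Commute (jkOf p (l, 1) a₁) (jkOf p (l, 1) a₂) :=
  commutatorElement_eq_one_iff_commute.1 (PresentedGroup.one_of_mem (rels := jkRels p (l, 1))
    (Or.inr (Or.inr (Or.inr (Or.inr (Or.inr (Or.inl rfl)))))))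

theorem jk_b₁_commute_b₂ : Commute (jkOf p (l, 1) b₁) (jkOf p (l, 1) b₂) :=
  commutatorElement_eq_one_iff_commute.1 (PresentedGroup.one_of_mem (rels := jkRels p (l, 1))
    (Or.inr (Or.inr (Or.inr (Or.inr (Or.inr (Or.inr rfl)))))))

variable [Fact p.Prime]

theorem jk_a₂_pow_eq : jkOf p (l, 1) a₂ ^ p =
    ⁅jkOf p (l, 1) a₁, jkOf p (l, 1) b₁ ^ l.val * jkOf p (l, 1) b₂⁆ := by
  have h : jkOf p (l, 1) a₂ ^ p * ⁅jkOf p (l, 1) a₁,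
      jkOf p (l, 1) b₁ ^ l.val * jkOf p (l, 1) b₂ ^ (1 : ZMod p).val⁆⁻¹ = 1 :=
    PresentedGroup.one_of_mem (rels := jkRels p (l, 1)) (Or.inr (Or.inr (Or.inl rfl)))
  rwa [ZMod.val_one, pow_one, mul_inv_eq_one] at h

theorem jk_pow_commute (s : JKGen) (x : JK p (l, 1)) : Commute (jkOf p (l, 1) s ^ p) x := by
  cases s
  · rw [jk_a₁_pow]; exact jk_commute _ _ _
  · rw [jk_a₂_pow_eq]; exact jk_commute _ _ _
  · rw [jk_b₁_pow_eq]; exact jk_commute _ _ _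
  · rw [jk_b₂_pow]; exact jk_commute _ _ _

theorem jk_commutator_pow (s : JKGen) (x : JK p (l, 1)) : ⁅jkOf p (l, 1) s, x⁆ ^ p = 1 := by
  rw [← zpow_natCast, ← commutator_zpow_left_of_central (jk_commute _ _), zpow_natCast,
    commutatorElement_eq_one_iff_commute]
  exact jk_pow_commute s x

theorem jk_pow_sq (s : JKGen) : jkOf p (l, 1) s ^ (p ^ 2) = 1 := by
  rw [sq, pow_mul]
  cases s
  · rw [jk_a₁_pow]; exact jk_commutator_pow _ _
  · rw [jk_a₂_pow_eq]; exact jk_commutator_pow _ _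
  · rw [jk_b₁_pow_eq]; exact jk_commutator_pow _ _
  · rw [jk_b₂_pow]; exact jk_commutator_pow _ _

theorem jk_a₂_pow : jkOf p (l, 1) a₂ ^ p =
    ⁅jkOf p (l, 1) a₁, jkOf p (l, 1) b₁⁆ ^ l.val * ⁅jkOf p (l, 1) a₁, jkOf p (l, 1) b₂⁆ := by
  rw [jk_a₂_pow_eq, commutator_mul_right_of_central (jk_commute _ _), ← zpow_natCast,
    commutator_zpow_right_of_central (jk_commute _ _), zpow_natCast]

theorem jk_b₁_pow : jkOf p (l, 1) b₁ ^ p =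
    ⁅jkOf p (l, 1) a₂, jkOf p (l, 1) b₁⁆ * ⁅jkOf p (l, 1) a₂, jkOf p (l, 1) b₂⁆ := by
  rw [jk_b₁_pow_eq, commutator_mul_right_of_central (jk_commute _ _)]

theorem jk_zpow_mul (x y : JK p (l, 1)) (m n : ℤ) :
    x ^ m * y ^ n = ⁅x, y⁆ ^ (m * n) * (y ^ n * x ^ m) :=
  zpow_mul_zpow_of_mul_eq (jk_commute _ _ _) (jk_commute _ _ _)
    (by simp [commutatorElement_def, mul_assoc]) m n

open scoped Pointwise in
/-- The products `a₁ ^ i * a₂ ^ j * b₁ ^ k * b₂ ^ m` are stable under left multiplication by the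
generators, because all commutators are products of `p`-th powers of generators. -/
theorem exists_eq_zpow_mul (x : JK p (l, 1)) : ∃ i : JKGen → ℤ, x =
    jkOf p (l, 1) a₁ ^ i a₁ * (jkOf p (l, 1) a₂ ^ i a₂ *
      (jkOf p (l, 1) b₁ ^ i b₁ * jkOf p (l, 1) b₂ ^ i b₂)) := by
  let S : Set (JK p (l, 1)) := {x | ∃ i j k m : ℤ, x =
    jkOf p (l, 1) a₁ ^ i * (jkOf p (l, 1) a₂ ^ j *
      (jkOf p (l, 1) b₁ ^ k * jkOf p (l, 1) b₂ ^ m))}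
  -- All generators lie in the stabilizer of `S` under left multiplication.
  let H : Subgroup (JK p (l, 1)) := MulAction.stabilizer (JK p (l, 1)) S
  have mem_H : ∀ g, (∀ n : ℤ, ∀ x ∈ S, g ^ n * x ∈ S) → g ∈ H := fun g hg => by
    refine MulAction.mem_stabilizer_set.2 fun x => ⟨fun h => ?_, fun h => ?_⟩
    · simpa using hg (-1) _ h
    · simpa using hg 1 _ h
  have H_mem : ∀ {g x}, g ∈ H → x ∈ S → g * x ∈ S := fun hg hx =>
    (MulAction.mem_stabilizer_set.1 hg _).2 hx
  have ha₁ : jkOf p (l, 1) a₁ ∈ H := mem_H _ <| by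
    rintro n _ ⟨i, j, k, m, rfl⟩
    exact ⟨n + i, j, k, m, by rw [zpow_add, mul_assoc]⟩
  have ha₂ : jkOf p (l, 1) a₂ ∈ H := mem_H _ <| by
    rintro n _ ⟨i, j, k, m, rfl⟩
    refine ⟨i, n + j, k, m, ?_⟩
    rw [zpow_add, ← mul_assoc, (jk_a₁_commute_a₂.symm.zpow_zpow n i).eq]
    simp only [mul_assoc]
  have hp : ∀ s (n : ℤ) (x : JK p (l, 1)), Commute ((jkOf p (l, 1) s ^ p) ^ n) x :=
    fun s n x => (jk_pow_commute s x).zpow_left n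
  have hb₂p : jkOf p (l, 1) b₂ ^ p ∈ H := mem_H _ <| by
    rintro n _ ⟨i, j, k, m, rfl⟩
    refine ⟨i, j, k, m + p * n, ?_⟩
    rw [(hp _ _ _).eq, zpow_add, zpow_mul, zpow_natCast]
    simp only [mul_assoc]
  have hb₁p : jkOf p (l, 1) b₁ ^ p ∈ H := mem_H _ <| by
    rintro n _ ⟨i, j, k, m, rfl⟩
    refine ⟨i, j, k + p * n, m, ?_⟩
    rw [(hp _ _ _).eq, zpow_add, zpow_mul, zpow_natCast]
    simp only [mul_assoc, (hp b₁ n _).eq]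
  have h11 : ⁅jkOf p (l, 1) a₁, jkOf p (l, 1) b₁⁆ ∈ H := jk_a₁_pow (p := p) (l := l) ▸ pow_mem ha₁ p
  have h22 : ⁅jkOf p (l, 1) a₂, jkOf p (l, 1) b₂⁆ ∈ H := jk_b₂_pow (p := p) (l := l) ▸ hb₂p
  have h12 : ⁅jkOf p (l, 1) a₁, jkOf p (l, 1) b₂⁆ ∈ H :=
    (H.mul_mem_cancel_left (pow_mem h11 l.val)).1 (jk_a₂_pow (p := p) (l := l) ▸ pow_mem ha₂ p)
  have h21 : ⁅jkOf p (l, 1) a₂, jkOf p (l, 1) b₁⁆ ∈ H :=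
    (H.mul_mem_cancel_right h22).1 (jk_b₁_pow (p := p) (l := l) ▸ hb₁p)
  have move : ∀ g, ⁅jkOf p (l, 1) a₁, g⁆ ∈ H → ⁅jkOf p (l, 1) a₂, g⁆ ∈ H → ∀ (n i j : ℤ) x,
      jkOf p (l, 1) a₁ ^ i * (jkOf p (l, 1) a₂ ^ j * (g ^ n * x)) ∈ S →
      g ^ n * (jkOf p (l, 1) a₁ ^ i * (jkOf p (l, 1) a₂ ^ j * x)) ∈ S := by
    intro g h1 h2 n i j x hx
    rw [← commutatorElement_inv] at h1 h2
    have h1 := zpow_mem ((H.inv_mem_iff).1 h1) (n * i)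
    have h2 := zpow_mem ((H.inv_mem_iff).1 h2) (n * j)
    convert H_mem h1 (H_mem h2 hx) using 1
    rw [← mul_assoc (g ^ n), jk_zpow_mul, mul_assoc, mul_assoc, ← mul_assoc (g ^ n),
      jk_zpow_mul g, ← mul_assoc (jkOf p (l, 1) a₁ ^ i), ← mul_assoc (jkOf p (l, 1) a₁ ^ i),
      ← ((jk_commute g (jkOf p (l, 1) a₂) (jkOf p (l, 1) a₁ ^ i)).zpow_left (n * j)).eq]
    simp only [mul_assoc]
  have hb₁ : jkOf p (l, 1) b₁ ∈ H := mem_H _ <| by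
    rintro n _ ⟨i, j, k, m, rfl⟩
    exact move _ h11 h21 _ _ _ _ ⟨i, j, n + k, m, by rw [zpow_add, mul_assoc]⟩
  have hb₂ : jkOf p (l, 1) b₂ ∈ H := mem_H _ <| by
    rintro n _ ⟨i, j, k, m, rfl⟩
    refine move _ h12 h22 _ _ _ _ ⟨i, j, k, n + m, ?_⟩
    rw [zpow_add, ← mul_assoc (_ ^ n), (jk_b₁_commute_b₂.symm.zpow_zpow n k).eq, mul_assoc]
  have hH : x ∈ H := PresentedGroup.generated_by _ H (fun s => by cases s <;> assumption) x
  obtain ⟨i, j, k, m, h⟩ := H_mem hH (x := 1) ⟨0, 0, 0, 0, by simp⟩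
  exact ⟨fun | .a₁ => i | .a₂ => j | .b₁ => k | .b₂ => m, by simpa using h⟩

end Presentation

namespace JKModel
open JKGen
variable {p : ℕ} {l : ZMod p} [Fact p.Prime]

/-- The inverse of `JKModel.ofJK`, as a map of sets. -/
def toJK (x : JKModel p l) : JK p (l, 1) :=
  jkOf p (l, 1) a₁ ^ (x.coord 0).val * jkOf p (l, 1) a₂ ^ (x.coord 1).val *
    jkOf p (l, 1) b₁ ^ (x.coord 2).val * jkOf p (l, 1) b₂ ^ (x.coord 3).val

theorem toJK_surjective : Function.Surjective (toJK : JKModel p l → _) := fun x => by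
  obtain ⟨i, rfl⟩ := exists_eq_zpow_mul x
  refine ⟨⟨![i a₁, i a₂, i b₁, i b₂]⟩, ?_⟩
  simp only [zpow_eq_pow_val (jk_pow_sq _)]
  simp [toJK, mul_assoc]

theorem gen_prod (n : Fin 4 → ℕ) :
    gen l a₁ ^ n 0 * gen l a₂ ^ n 1 * gen l b₁ ^ n 2 * gen l b₂ ^ n 3 = ⟨fun i => n i⟩ := by
  apply ext' <;> simp [coord_mul, coord_pow, gen, jkTwist]

theorem ofJK_toJK (hp : Odd p) (x : JKModel p l) : ofJK hp l (toJK x) = x := by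
  simp only [toJK, map_mul, map_pow, ofJK_gen]
  rw [gen_prod fun i => (x.coord i).val]
  ext i
  simp

theorem ofJK_bijective (hp : Odd p) : Function.Bijective (ofJK hp l) := by
  constructor
  · intro x y h
    obtain ⟨x, rfl⟩ := toJK_surjective x
    obtain ⟨y, rfl⟩ := toJK_surjective y
    rw [ofJK_toJK, ofJK_toJK] at h
    rw [h]
  · exact fun x => ⟨_, ofJK_toJK hp x⟩

/-- The coordinates, as `p`-th powers of `a₁, a₂, b₁, b₂`, of the product
`⁅a₁, b₁⁆ ^ r₀ * ⁅a₁, b₂⁆ ^ r₁ * ⁅a₂, b₁⁆ ^ r₂ * ⁅a₂, b₂⁆ ^ r₃`. -/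
def commCoord (l : ZMod p) : (Fin 4 → ZMod p) ≃ₗ[ZMod p] (Fin 4 → ZMod p) where
  toFun r := ![r 0 - l * r 1, r 1, r 2, r 3 - r 2]
  map_add' r s := by ext i; fin_cases i <;> simp <;> ring
  map_smul' t r := by ext i; fin_cases i <;> simp <;> ring
  invFun s := ![s 0 + l * s 1, s 1, s 2, s 3 + s 2]
  left_inv r := by ext i; fin_cases i <;> simp
  right_inv r := by ext i; fin_cases i <;> simp

/-- The representative of `k` in the model with coordinates in `{0, …, p - 1}`. -/
def base (l : ZMod p) (k : Fin 4 → ZMod p) : JKModel p l := ⟨fun i => (k i).val⟩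

theorem red_base (k : Fin 4 → ZMod p) : red (base l k) = k := redModP_comp_val k

theorem ofJK_normalForm (hp : Odd p) (k r : Fin 4 → ZMod p) :
    ofJK hp l (jkNormalForm p (l, 1) k r) = base l k * embed l (commCoord l r) := by
  simp only [jkNormalForm, map_mul, map_pow, map_commutatorElement, ofJK_gen]
  rw [gen_prod fun i => (k i).val]
  simp only [commutator_eq, ← embed_nsmul, mul_assoc, ← embed_add]
  congr 2
  ext i
  fin_cases i <;> simp [red_a₁, red_a₂, red_b₁, red_b₂, jkBracket_apply, commCoord] <;> ring

theorem base_mul_embed_injective {k k' v v' : Fin 4 → ZMod p}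
    (h : base l k * embed l v = base l k' * embed l v') : k = k' ∧ v = v' := by
  have hk : k = k' := by
    simpa [red_mul, red_embed, red_base] using congrArg red h
  subst hk
  exact ⟨rfl, embed_injective (mul_left_cancel h)⟩

theorem exists_eq_base_mul_embed (x : JKModel p l) : ∃ k v, x = base l k * embed l v := by
  have : red ((base l (red x))⁻¹ * x) = 0 := by
    have h := red_mul (base l (red x)) ((base l (red x))⁻¹ * x)
    rwa [mul_inv_cancel_left, red_base, left_eq_add] at h
  obtain ⟨v, hv⟩ := red_eq_zero_iff.1 this
  exact ⟨_, v, by rw [← hv, mul_inv_cancel_left]⟩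

end JKModel

open JKModel in
theorem jkNormalForm_bijective {p : ℕ} [Fact p.Prime] (hp : Odd p) (l : ZMod p) :
    Function.Bijective
      (fun c : (Fin 4 → ZMod p) × (Fin 4 → ZMod p) => jkNormalForm p (l, 1) c.1 c.2) := by
  rw [← (ofJK_bijective (l := l) hp).of_comp_iff']
  constructor
  · rintro ⟨k, r⟩ ⟨k', r'⟩ h
    simp only [Function.comp_apply, ofJK_normalForm] at h
    obtain ⟨rfl, hr⟩ := base_mul_embed_injective h
    rw [(commCoord l).injective hr]
  · intro x
    obtain ⟨k, v, rfl⟩ := exists_eq_base_mul_embed x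
    exact ⟨(k, (commCoord l).symm v), by simp [ofJK_normalForm]⟩

/-! ### Approximability -/

section Approximability

variable {G : Type*} [Group G]

theorem one_le_affappFun (f : G → G) : 1 ≤ affappFun f :=
  le_iSup₂_of_le (f := fun (B : G → G) (_ : B ∈ affMaps G) => {y | B y = f y}.encard)
    (fun _ => f 1) ⟨f 1, 1, fun _ => by simp⟩ (Set.one_le_encard_iff_nonempty.2 ⟨1, rfl⟩)

theorem affappFun_eq_one {f : G → G}
    (hf : ∀ (g : G) (φ : G →* G) (x y : G), g * φ x = f x → g * φ y = f y → x = y) :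
    affappFun f = 1 := by
  refine le_antisymm (iSup₂_le ?_) (one_le_affappFun f)
  rintro A ⟨g, φ, hA⟩
  refine Set.encard_le_one_iff.2 fun x y hx hy => ?_
  exact hf g φ x y ((hA x).symm.trans hx) ((hA y).symm.trans hy)

/-- Translate `f` to fix `1`, where every endomorphism meets it, and then move the value at `1`. -/
theorem enapp_eq_zero_of_affappFun_eq_one [Nontrivial G] {f : G → G} (hf : affappFun f = 1) :
    enapp G = 0 := by
  classical
  obtain ⟨t, ht⟩ := exists_ne (1 : G)
  have key : approximability (endMaps G) (Function.update (fun x => (f 1)⁻¹ * f x) 1 t) = 0 := by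
    refine le_antisymm (iSup₂_le ?_) bot_le
    rintro A ⟨φ, hA⟩
    rw [nonpos_iff_eq_zero, Set.encard_eq_zero, Set.eq_empty_iff_forall_notMem]
    intro x hx
    have hx' := (hA x).symm.trans hx
    by_cases h1 : x = 1
    · subst h1
      rw [map_one, Function.update_self] at hx'
      exact ht hx'.symm
    · rw [Function.update_of_ne h1] at hx'
      have hle : {y | (fun y => f 1 * φ y) y = f y}.encard ≤ 1 :=
        hf ▸ le_iSup₂_of_le (f := fun (B : G → G) (_ : B ∈ affMaps G) =>
          {y | B y = f y}.encard) _ ⟨f 1, φ, fun _ => rfl⟩ le_rfl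
      refine h1 (Set.encard_le_one_iff.1 hle x 1 ?_ ?_)
      · simp [hx']
      · simp
  exact le_antisymm (iInf_le_of_le _ key.le) bot_le

end Approximability

namespace JKModel

variable {p : ℕ} {l : ZMod p} [Fact p.Prime]

/-- If `φ` is central-valued, reduction modulo commutators makes `σ` constant on the parts `k` of
the agreement points; if `φ` is the identity modulo commutators, it makes `σ - 1` constant there.
The parts `v` are compared in the same way. -/
theorem eq_of_affine_agreement (hp : Odd p) {σ τ : (Fin 4 → ZMod p) ≃ₗ[ZMod p] (Fin 4 → ZMod p)}
    (hσ : ∀ v, σ v = v → v = 0) (hτ : ∀ v, τ v = v → v = 0) {F : JKModel p l → JKModel p l}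
    (hF : ∀ k v, F (base l k * embed l v) = base l (σ k) * embed l (τ v))
    (g : JKModel p l) (φ : JKModel p l →* JKModel p l) {x y : JKModel p l}
    (hx : g * φ x = F x) (hy : g * φ y = F y) : x = y := by
  obtain ⟨k, v, rfl⟩ := exists_eq_base_mul_embed x
  obtain ⟨k', v', rfl⟩ := exists_eq_base_mul_embed y
  rw [hF] at hx hy
  have hrx := congrArg red hx
  have hry := congrArg red hy
  rcases endo_dichotomy hp φ with ⟨hφ, hφ'⟩ | ⟨hφ, hφ'⟩
  · simp only [red_mul, hφ, red_embed, red_base, add_zero] at hrx hry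
    obtain rfl := σ.injective (hrx.symm.trans hry)
    simp only [map_mul, hφ', mul_one] at hx hy
    rw [τ.injective (base_mul_embed_injective (hx.symm.trans hy)).2]
  · simp only [red_mul, hφ, red_embed, red_base, add_zero] at hrx hry
    have hk : k = k' := sub_eq_zero.1 (hσ _ (by
      rw [map_sub, ← hrx, ← hry, add_sub_add_left_eq_sub]))
    subst hk
    have hv : τ v + v' = τ v' + v := by
      refine (base_mul_embed_injective (k := σ k) (k' := σ k) (l := l) ?_).2
      rw [embed_add, embed_add, ← mul_assoc, ← mul_assoc, ← hx, ← hy]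
      simp only [map_mul, hφ', mul_assoc, commute_embed (embed l v)]
    have : v = v' := sub_eq_zero.1 (hτ _ (by
      rw [map_sub, sub_eq_sub_iff_add_eq_add, hv, add_comm]))
    rw [this]

end JKModel

open JKModel in
theorem exists_jkNormalForm_map {p : ℕ} [Fact p.Prime] (hp : Odd p) (l : ZMod p)
    (σ : (Fin 4 → ZMod p) ≃ₗ[ZMod p] (Fin 4 → ZMod p)) (hσ : ∀ v, σ v = v → v = 0) :
    ∃ f : JK p (l, 1) → JK p (l, 1),
      (∀ k r, f (jkNormalForm p (l, 1) k r) = jkNormalForm p (l, 1) (σ k) (σ r)) ∧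
        affappFun f = 1 := by
  let N := Equiv.ofBijective _ (jkNormalForm_bijective hp l)
  let f : JK p (l, 1) → JK p (l, 1) := fun x => N (σ (N.symm x).1, σ (N.symm x).2)
  have hf : ∀ k r, f (jkNormalForm p (l, 1) k r) = jkNormalForm p (l, 1) (σ k) (σ r) := by
    intro k r
    have : N.symm (jkNormalForm p (l, 1) k r) = (k, r) := N.symm_apply_apply (k, r)
    simp only [f, this]
    rfl
  refine ⟨f, hf, affappFun_eq_one fun g φ x y hx hy => ?_⟩
  let e := MulEquiv.ofBijective (ofJK hp l) (ofJK_bijective hp)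
  -- The action of `σ` on commutator exponents, in the coordinates of the model.
  let τ := (commCoord l).symm ≪≫ₗ σ ≪≫ₗ commCoord l
  have hτ : ∀ v, τ v = v → v = 0 := fun v hv => by
    have h := hσ ((commCoord l).symm v) ((LinearEquiv.eq_symm_apply _).2 hv)
    simpa using h
  have hN : ∀ k v, e.symm (base l k * embed l v) = jkNormalForm p (l, 1) k ((commCoord l).symm v) :=
    fun k v => by
      rw [MulEquiv.symm_apply_eq]
      exact ((ofJK_normalForm hp _ _).trans (by rw [LinearEquiv.apply_symm_apply])).symm
  have hF : ∀ k v, e (f (e.symm (base l k * embed l v))) = base l (σ k) * embed l (τ v) :=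
    fun k v => by
      rw [hN, hf]
      exact ofJK_normalForm hp _ _
  have tr : ∀ z, g * φ z = f z → e g * (e.toMonoidHom.comp (φ.comp e.symm.toMonoidHom)) (e z) =
      e (f (e.symm (e z))) := fun z hz => by
    rw [e.symm_apply_apply, ← hz, map_mul]
    simp
  exact e.injective (eq_of_affine_agreement hp hσ hτ (F := fun w => e (f (e.symm w))) hF (e g)
    (e.toMonoidHom.comp (φ.comp e.symm.toMonoidHom)) (tr x hx) (tr y hy))

theorem mainTheorem2 (p : ℕ) [Fact p.Prime] (hp : Odd p) (l₁ : ZMod p) :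
    Function.Bijective
      (fun c : (Fin 4 → ZMod p) × (Fin 4 → ZMod p) => jkNormalForm p (l₁, 1) c.1 c.2) ∧
    (∀ σ : (Fin 4 → ZMod p) ≃ₗ[ZMod p] (Fin 4 → ZMod p), (∀ v, σ v = v → v = 0) →
      ∃ f : JK p (l₁, 1) → JK p (l₁, 1),
        (∀ k r : Fin 4 → ZMod p,
          f (jkNormalForm p (l₁, 1) k r) = jkNormalForm p (l₁, 1) (σ k) (σ r)) ∧
        affappFun f = 1) ∧
    affapp (JK p (l₁, 1)) = 1 ∧
    enapp (JK p (l₁, 1)) = 0 := by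
  have hneg : ∀ v : Fin 4 → ZMod p, LinearEquiv.neg (ZMod p) v = v → v = 0 := fun v hv => by
    ext i
    have h2 : (2 : ZMod p) ≠ 0 := by
      have : Fact (2 < p) := ⟨(Fact.out : p.Prime).two_le.lt_of_ne
        (by rintro rfl; exact absurd hp (by decide))⟩
      exact Ring.two_ne_zero (by rw [ZMod.ringChar_zmod_n]; exact this.out.ne')
    have h : 2 * v i = 0 := by
      have := congrFun hv i
      simp only [LinearEquiv.neg_apply, Pi.neg_apply] at this
      linear_combination -this
    exact (mul_eq_zero.1 h).resolve_left h2
  -- Negation is a fixed-point-free automorphism as `p` is odd.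
  obtain ⟨f, -, hf⟩ := exists_jkNormalForm_map hp l₁ _ hneg
  have : Nontrivial (JK p (l₁, 1)) :=
    (Equiv.ofBijective _ (jkNormalForm_bijective hp l₁)).symm.nontrivial
  exact ⟨jkNormalForm_bijective hp l₁, exists_jkNormalForm_map hp l₁,
    le_antisymm (iInf_le_of_le f hf.le) (le_iInf one_le_affappFun),
    enapp_eq_zero_of_affappFun_eq_one hf⟩
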